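/- Let $a$ and $b$ be positive integers with $a>b$, $a\not\equiv b\pmod 2$ and $\gcd(a,b)=1$. (i) If $2\mid a$, then for every $n\in\mathbb N=\{0,1,2,\ldots\}$ with $n\ge 2^{1+(-1)^n}a^3+(3+(-1)^n)ab$ there are $w,x,y,z\in\mathbb Z$ such that $$n=w(aw+b)+x(ax+b)+y(ay+b)+z(az+b).$$ (ii) If $2\mid b$, then every integer $n\ge a^3+2ab$ with $4\nmid n$ can be written as $$n=w(aw+b)+x(ax+b)+y(ay+b)+z(az+b)$$ with $w,x,y,z\in\mathbb Z$. -/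

import Mathlib

/-! The right side is aA + bB, with A the sum of the squares of the variables and B their sum. By
Cauchy's lemma (`exists_four_of_odd`, `exists_four_of_even`) such variables exist when B² ≤ 4A and
A, B are both odd, or A ≡ 2 mod 4 and B is even. Coprimality gives n = aA + bB with these parities
and |B| ≤ 2a; then n ≥ a³ + 2ab forces A ≥ a², so B² ≤ 4A. Cauchy's lemma rests on the three-square
theorem, proved from ternary forms of determinant one, primes in progressions and reciprocity. -/

/-- An integer is a sum of three integer squares. -/
def IsSumThreeSq (n : ℤ) : Prop := ∃ r s t : ℤ, n = r ^ 2 + s ^ 2 + t ^ 2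

/-! ### Reduction of forms of determinant one. -/

/-- A shift by a multiple of `u` that brings `v` into the interval `[-u/2, u/2]`. -/
theorem exists_abs_two_mul_add_le (u v : ℤ) (hu : 0 < u) :
    ∃ k : ℤ, |2 * (v + k * u)| ≤ u := by
  refine ⟨-((2 * v + u) / (2 * u)), ?_⟩
  have h1 := Int.emod_add_mul_ediv (2 * v + u) (2 * u)
  have h2 := Int.emod_nonneg (2 * v + u) (b := 2 * u) (by omega)
  have h3 := Int.emod_lt_of_pos (2 * v + u) (b := 2 * u) (by omega)
  rw [abs_le]
  constructor <;> nlinarith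

/-- Gauss reduction of a positive definite binary form. -/
theorem exists_reduced_binary (u v w : ℤ) (hu : 0 < u) (hD : 0 < u * w - v ^ 2) :
    ∃ p q r s : ℤ, p * s - q * r = 1 ∧ 0 < u * p ^ 2 + 2 * v * p * r + w * r ^ 2 ∧
      3 * (u * p ^ 2 + 2 * v * p * r + w * r ^ 2) ^ 2 ≤ 4 * (u * w - v ^ 2) := by
  induction hn : u.toNat using Nat.strong_induction_on generalizing u v w with
  | _ n ih =>
    obtain ⟨k, hk⟩ := exists_abs_two_mul_add_le u v hu
    obtain ⟨w', hw'⟩ : ∃ w', w' = u * k ^ 2 + 2 * v * k + w := ⟨_, rfl⟩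
    obtain ⟨v', hv'⟩ : ∃ v', v' = v + k * u := ⟨_, rfl⟩
    rw [← hv'] at hk
    have hdet : u * w' - v' ^ 2 = u * w - v ^ 2 := by subst hw' hv'; ring
    have hsq : 4 * v' ^ 2 ≤ u ^ 2 := by
      have := sq_le_sq' (abs_le.mp hk).1 (abs_le.mp hk).2
      linarith
    by_cases h : u ≤ w'
    · refine ⟨1, 0, 0, 1, by norm_num, by simpa using hu, ?_⟩
      have : u * u ≤ u * w' := mul_le_mul_of_nonneg_left h hu.le
      simp
      linarith
    · have hw0 : 0 < w' := by
        have : 0 < u * w' := by nlinarith [sq_nonneg v']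
        exact pos_of_mul_pos_right this hu.le
      obtain ⟨p, q, r, s, h1, h2, h3⟩ :=
        ih w'.toNat (by omega) w' (-v') u hw0 (by nlinarith) rfl
      have key : w' * p ^ 2 + 2 * -v' * p * r + u * r ^ 2
          = u * (k * p - r) ^ 2 + 2 * v * (k * p - r) * p + w * p ^ 2 := by
        subst hw' hv'; ring
      rw [key] at h2 h3
      refine ⟨k * p - r, k * q - s, p, q, by linarith, h2, ?_⟩
      calc _ ≤ _ := h3
        _ = _ := by linarith

/-- A positive binary form of determinant one takes only sums of two squares as values. -/
theorem binary_det_one_eq_sq_add_sq (u v w : ℤ) (hu : 0 < u) (hD : u * w - v ^ 2 = 1)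
    (y z : ℤ) : ∃ s t : ℤ, u * y ^ 2 + 2 * v * y * z + w * z ^ 2 = s ^ 2 + t ^ 2 := by
  obtain ⟨p, q, r, s, h1, h2, h3⟩ := exists_reduced_binary u v w hu (by omega)
  rw [hD] at h3
  have hone : u * p ^ 2 + 2 * v * p * r + w * r ^ 2 = 1 := by nlinarith
  refine ⟨(s * y - q * z) + (u * p * q + v * (p * s + q * r) + w * r * s) * (p * z - r * y),
    p * z - r * y, ?_⟩
  have e1 : y = p * (s * y - q * z) + q * (p * z - r * y) := by linear_combination (-y) * h1
  have e2 : z = r * (s * y - q * z) + s * (p * z - r * y) := by linear_combination (-z) * h1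
  generalize hY : s * y - q * z = Y at *
  generalize hZ : p * z - r * y = Z at *
  have hdet : (u * p ^ 2 + 2 * v * p * r + w * r ^ 2) * (u * q ^ 2 + 2 * v * q * s + w * s ^ 2)
      - (u * p * q + v * (p * s + q * r) + w * r * s) ^ 2 = 1 := by
    have : (u * p ^ 2 + 2 * v * p * r + w * r ^ 2) * (u * q ^ 2 + 2 * v * q * s + w * s ^ 2)
      - (u * p * q + v * (p * s + q * r) + w * r * s) ^ 2
      = (u * w - v ^ 2) * (p * s - q * r) ^ 2 := by ring
    rw [this, hD, h1]; norm_num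
  rw [hone] at hdet
  rw [e1, e2]
  linear_combination Y ^ 2 * hone + Z ^ 2 * hdet

/-- A positive definite ternary form with integral matrix of determinant one takes only sums of
three squares as values. -/
theorem ternary_det_one_isSumThreeSq (a b c d e f : ℤ) (ha : 0 < a) (hab : 0 < a * b - f ^ 2)
    (hdet : a * b * c + 2 * d * e * f - a * d ^ 2 - b * e ^ 2 - c * f ^ 2 = 1) (x y z : ℤ) :
    IsSumThreeSq (a * x ^ 2 + b * y ^ 2 + c * z ^ 2 + 2 * d * y * z + 2 * e * x * z
      + 2 * f * x * y) := by
  induction hn : a.toNat using Nat.strong_induction_on generalizing a b c d e f x y z with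
  | _ n ih =>
    by_cases ha1 : a = 1
    · subst ha1
      obtain ⟨s, t, hst⟩ := binary_det_one_eq_sq_add_sq (b - f ^ 2) (d - e * f) (c - e ^ 2)
        (by linarith) (by linarith) y z
      exact ⟨x + f * y + e * z, s, t, by linear_combination hst⟩
    -- This binary form of determinant `a` is what remains after completing the square in x.
    -- Reducing it makes `a * b' - f' ^ 2` so small that `b' < a` unless `a = 1`; swapping the first
    -- two variables then gives the descent.
    have hG : (a * b - f ^ 2) * (a * c - e ^ 2) - (a * d - e * f) ^ 2 = a := by
      linear_combination a * hdet
    obtain ⟨p, q, r, s, h1, h2, h3⟩ := exists_reduced_binary (a * b - f ^ 2) (a * d - e * f)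
      (a * c - e ^ 2) hab (by omega)
    rw [hG] at h3
    obtain ⟨k, hk⟩ := exists_abs_two_mul_add_le a (f * p + e * r) ha
    obtain ⟨f', hf'⟩ : ∃ f', f' = f * p + e * r + k * a := ⟨_, rfl⟩
    obtain ⟨b', hb'⟩ : ∃ b', b' = a * k ^ 2 + 2 * (f * p + e * r) * k
      + b * p ^ 2 + 2 * d * p * r + c * r ^ 2 := ⟨_, rfl⟩
    rw [← hf'] at hk
    have hsq : 4 * f' ^ 2 ≤ a ^ 2 := by
      have := sq_le_sq' (abs_le.mp hk).1 (abs_le.mp hk).2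
      linarith
    have hG11 : (a * b - f ^ 2) * p ^ 2 + 2 * (a * d - e * f) * p * r + (a * c - e ^ 2) * r ^ 2
      = a * b' - f' ^ 2 := by subst hf' hb'; ring
    rw [hG11] at h2 h3
    have hb0 : 0 < b' := by
      have : 0 < a * b' := by nlinarith [sq_nonneg f']
      exact pos_of_mul_pos_right this ha.le
    have hba : b' < a := by
      by_contra! hle
      have h4 : a * a ≤ a * b' := mul_le_mul_of_nonneg_left hle ha.le
      have h5 : 3 * a ^ 2 ≤ 4 * (a * b' - f' ^ 2) := by linarith
      have h6 : (3 * a ^ 2) ^ 2 ≤ (4 * (a * b' - f' ^ 2)) ^ 2 :=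
        pow_le_pow_left₀ (by positivity) h5 2
      have h7 : 27 * a ^ 4 ≤ 64 * a := by nlinarith
      have h8 : 27 * a ^ 3 ≤ 64 := by
        by_contra! h9
        nlinarith [mul_lt_mul_of_pos_left h9 ha]
      have h9 : (2 : ℤ) ^ 3 ≤ a ^ 3 := pow_le_pow_left₀ (by norm_num) (by omega) 3
      linarith
    have main := ih b'.toNat (by omega) b' a (b * q ^ 2 + 2 * d * q * s + c * s ^ 2)
      (f * q + e * s)
      (k * (f * q + e * s) + b * p * q + d * (p * s + q * r) + c * r * s) f' hb0 (by linarith)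
      (by
        have : (p * s - q * r) ^ 2 = 1 := by rw [h1]; norm_num
        subst hf' hb'
        linear_combination (p * s - q * r) ^ 2 * hdet + this)
      (s * y - q * z) (x - k * (s * y - q * z)) (p * z - r * y) rfl
    have e1 : y = p * (s * y - q * z) + q * (p * z - r * y) := by linear_combination (-y) * h1
    have e2 : z = r * (s * y - q * z) + s * (p * z - r * y) := by linear_combination (-z) * h1
    convert main using 1
    generalize hY : s * y - q * z = Y at *
    generalize hZ : p * z - r * y = Z at *
    rw [e1, e2]
    subst hf' hb'
    ring

/-! ### Sums of three squares. -/

/-- If `-d` is a square modulo `d * n - 1`, then `n` is a sum of three squares. -/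
theorem isSumThreeSq_of_dvd (n d x : ℤ) (hd : 0 < d) (hm : 0 < d * n - 1)
    (h : d * n - 1 ∣ x ^ 2 + d) : IsSumThreeSq n := by
  obtain ⟨a, ha⟩ := h
  have ha0 : 0 < a := by
    have : 0 < (d * n - 1) * a := by rw [← ha]; positivity
    exact pos_of_mul_pos_right this hm.le
  have := ternary_det_one_isSumThreeSq a (d * n - 1) n 0 1 x ha0 (by linarith)
    (by linear_combination (-n) * ha) 0 0 1
  simpa using this

theorem exists_dvd_sq_add_of_jacobiSym (p : ℕ) [Fact p.Prime] (d : ℤ)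
    (h : jacobiSym (-d) p = 1) : ∃ x : ℤ, (p : ℤ) ∣ x ^ 2 + d := by
  obtain ⟨y, hy⟩ := ZMod.isSquare_of_jacobiSym_eq_one h
  obtain ⟨x, rfl⟩ := ZMod.intCast_surjective y
  refine ⟨x, (ZMod.intCast_zmod_eq_zero_iff_dvd _ p).mp ?_⟩
  push_cast at hy ⊢
  linear_combination -hy

/-- Take a prime p = dn - 1 with d = 4j + 1. As p ≡ 1 mod 4 and p ≡ -1 mod d, reciprocity gives
(-d/p) = (p/d) = (-1/d) = 1. -/
theorem isSumThreeSq_of_mod_four_eq_two (n : ℕ) (hn : n % 4 = 2) : IsSumThreeSq n := by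
  have hcop : (n - 1).Coprime (4 * n) := by
    have h1 : (n - 1).Coprime n := by
      have := Nat.coprime_self_add_right (m := n - 1) (n := 1)
      rw [Nat.sub_add_cancel (by omega)] at this
      simpa using this
    refine Nat.Coprime.mul_right ?_ h1
    rw [show 4 = 2 ^ 2 by norm_num]
    exact Nat.Coprime.pow_right 2 (Nat.coprime_two_right.mpr
      (Nat.odd_iff.mpr (by omega)))
  obtain ⟨p, hgt, hp, hmod⟩ := Nat.forall_exists_prime_gt_and_modEq n (by omega) hcop
  have := Fact.mk hp
  obtain ⟨j, hj⟩ := (Nat.modEq_iff_dvd' (by omega)).mp hmod.symm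
  have hp4 : p % 4 = 1 := by
    have : p = 4 * (n * j) + (n - 1) := by rw [← mul_assoc]; omega
    omega
  have hpd : (p : ℤ) = ((4 * j + 1 : ℕ) : ℤ) * n - 1 := by
    have : p + 1 = (4 * j + 1) * n := by
      have : p + 1 = 4 * n * j + n := by omega
      rw [this]; ring
    have h2 : ((p + 1 : ℕ) : ℤ) = (((4 * j + 1) * n : ℕ) : ℤ) := by rw [this]
    push_cast at h2 ⊢
    linarith
  have hdodd : Odd (4 * j + 1) := Nat.odd_iff.mpr (by omega)
  have hpodd : Odd p := Nat.odd_iff.mpr (by omega)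
  have hJ : jacobiSym (-((4 * j + 1 : ℕ) : ℤ)) p = 1 := by
    rw [jacobiSym.neg _ hpodd, ZMod.χ₄_nat_one_mod_four hp4, one_mul,
      jacobiSym.quadratic_reciprocity_one_mod_four (by omega) hpodd,
      jacobiSym.mod_left' (a₂ := -1), jacobiSym.at_neg_one hdodd,
      ZMod.χ₄_nat_one_mod_four (by omega)]
    rw [hpd]
    exact Int.emod_eq_emod_iff_emod_sub_eq_zero.mpr (by simp)
  obtain ⟨x, hx⟩ := exists_dvd_sq_add_of_jacobiSym p _ hJ
  refine isSumThreeSq_of_dvd n ((4 * j + 1 : ℕ) : ℤ) x (by positivity) ?_ (by rwa [← hpd])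
  rw [← hpd]
  exact_mod_cast hp.pos

/-- The common part of the odd residue classes: `c` is chosen with `c * n ≡ 3 [MOD 4]`. -/
theorem isSumThreeSq_of_odd_aux (n c m : ℕ) (hn : n % 2 = 1) (hm : m % 2 = 1)
    (hc : c * n = 2 * m + 1) (hc8 : c % 8 = 1 ∨ c % 8 = 3)
    (hmc : m % 4 = 1 ∨ (m % 4 = 3 ∧ c % 4 = 3)) : IsSumThreeSq n := by
  have hcop : m.Coprime (4 * n) := by
    have h1 : m.Coprime n := by
      have h : (2 * m + 1).Coprime m := by simp
      rw [← hc] at h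
      exact (Nat.Coprime.coprime_mul_left h).symm
    refine Nat.Coprime.mul_right ?_ h1
    rw [show 4 = 2 ^ 2 by norm_num]
    exact Nat.Coprime.pow_right 2 (Nat.coprime_two_right.mpr (Nat.odd_iff.mpr hm))
  obtain ⟨p, hgt, hp, hmod⟩ := Nat.forall_exists_prime_gt_and_modEq m (by omega) hcop
  have := Fact.mk hp
  obtain ⟨j, hj⟩ := (Nat.modEq_iff_dvd' hgt.le).mp hmod.symm
  have hpm : p = 4 * (n * j) + m := by rw [← mul_assoc]; omega
  obtain ⟨d, hd⟩ : ∃ d, d = 8 * j + c := ⟨_, rfl⟩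
  have hpd : 2 * (p : ℤ) = (d : ℤ) * n - 1 := by
    have h2 : ((c * n : ℕ) : ℤ) = ((2 * m + 1 : ℕ) : ℤ) := by rw [hc]
    subst hpm hd
    push_cast at h2 ⊢
    linear_combination -h2
  have hdodd : Odd d := Nat.odd_iff.mpr (by omega)
  have hpodd : Odd p := Nat.odd_iff.mpr (by omega)
  have hsymm : jacobiSym (-(d : ℤ)) p = jacobiSym p d := by
    rw [jacobiSym.neg _ hpodd]
    rcases hmc with h | ⟨h, h'⟩
    · rw [ZMod.χ₄_nat_one_mod_four (by omega), one_mul,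
        jacobiSym.quadratic_reciprocity_one_mod_four' hdodd (by omega)]
    · rw [ZMod.χ₄_nat_three_mod_four (by omega),
        jacobiSym.quadratic_reciprocity_three_mod_four (by omega) (by omega)]
      ring
  -- Since -2p ≡ 1 mod d, this forces (p/d) = 1.
  have hneg2 : jacobiSym (-2) d = 1 := by
    rw [jacobiSym.at_neg_two hdodd, ZMod.χ₈'_nat_eq_if_mod_eight]
    have : d % 8 = 1 ∨ d % 8 = 3 := by omega
    rw [if_neg (by omega), if_pos this]
  have hJ : jacobiSym (-(d : ℤ)) p = 1 := by
    rw [hsymm]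
    have : jacobiSym (-2 * (p : ℤ)) d = 1 := by
      rw [jacobiSym.mod_left' (a₂ := 1), jacobiSym.one_left]
      rw [show -2 * (p : ℤ) = 1 - d * n by linarith]
      exact Int.emod_eq_emod_iff_emod_sub_eq_zero.mpr (by simp)
    rwa [jacobiSym.mul_left, hneg2, one_mul] at this
  obtain ⟨x, hx⟩ := exists_dvd_sq_add_of_jacobiSym p _ hJ
  -- The modulus is 2p, so the root must also be odd.
  obtain ⟨y, hy, hyodd⟩ : ∃ y : ℤ, (p : ℤ) ∣ y ^ 2 + d ∧ y % 2 = 1 := by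
    rcases Int.emod_two_eq_zero_or_one x with h | h
    · refine ⟨x + p, ?_, by have := Nat.odd_iff.mp hpodd; omega⟩
      have : (x + p) ^ 2 + (d : ℤ) = (x ^ 2 + d) + p * (2 * x + p) := by ring
      rw [this]
      exact dvd_add hx (dvd_mul_right _ _)
    · exact ⟨x, hx, h⟩
  have h2 : (2 : ℤ) ∣ y ^ 2 + d := by
    have : (y ^ 2) % 2 = 1 := by rw [pow_two, Int.mul_emod, hyodd]; norm_num
    have := Nat.odd_iff.mp hdodd
    omega
  have hcop2 : IsCoprime (2 : ℤ) p := by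
    rw [Int.isCoprime_iff_gcd_eq_one]
    exact_mod_cast Nat.coprime_two_left.mpr hpodd
  refine isSumThreeSq_of_dvd n d y ?_ ?_ ?_
  · have := Nat.odd_iff.mp hdodd
    omega
  · rw [← hpd]
    have := hp.pos
    omega
  · rw [← hpd]
    exact hcop2.mul_dvd h2 hy

/-- The part of the Legendre–Gauss three-square theorem away from multiples of four. -/
theorem isSumThreeSq_of_mod_eight (n : ℤ) (h0 : 0 ≤ n)
    (h : n % 4 = 1 ∨ n % 4 = 2 ∨ n % 8 = 3) : IsSumThreeSq n := by
  lift n to ℕ using h0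
  by_cases h2 : n % 4 = 2
  · exact isSumThreeSq_of_mod_four_eq_two n h2
  by_cases h3 : n % 8 = 3
  · exact isSumThreeSq_of_odd_aux n 1 (n / 2) (by omega) (by omega) (by omega) (by norm_num)
      (by omega)
  · exact isSumThreeSq_of_odd_aux n 3 (3 * n / 2) (by omega) (by omega) (by omega) (by norm_num)
      (by omega)

/-! ### Cauchy's lemma. -/

theorem exists_four_of_odd (A B : ℤ) (hA : A % 2 = 1) (hB : B % 2 = 1) (h : B ^ 2 ≤ 4 * A) :
    ∃ w x y z : ℤ, w ^ 2 + x ^ 2 + y ^ 2 + z ^ 2 = A ∧ w + x + y + z = B := by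
  have hodd : ∀ r : ℤ, r ^ 2 % 8 = 1 ∧ r % 2 = 1 ∨ r ^ 2 % 8 = 0 ∧ r % 2 = 0 ∨
      r ^ 2 % 8 = 4 ∧ r % 2 = 0 := by
    intro r
    have : r % 8 = 0 ∨ r % 8 = 1 ∨ r % 8 = 2 ∨ r % 8 = 3 ∨ r % 8 = 4 ∨ r % 8 = 5 ∨ r % 8 = 6 ∨
      r % 8 = 7 := by omega
    rcases this with h | h | h | h | h | h | h | h <;>
      simp [pow_two, Int.mul_emod, h] <;> omega
  obtain ⟨r, s, t, hrst⟩ := isSumThreeSq_of_mod_eight (4 * A - B ^ 2) (by linarith)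
    (by have := hodd B; omega)
  have hr : r % 2 = 1 ∧ s % 2 = 1 ∧ t % 2 = 1 := by
    have := hodd r
    have := hodd s
    have := hodd t
    have := hodd B
    omega
  -- The solution is (B ± r ± s ± t')/4 with an even number of minus signs; the sign of t makes it
  -- integral.
  obtain ⟨t', ht', hmod⟩ : ∃ t' : ℤ, t' ^ 2 = t ^ 2 ∧ (B + r + s + t') % 4 = 0 := by
    by_cases h4 : (B + r + s + t) % 4 = 0
    · exact ⟨t, rfl, h4⟩
    · exact ⟨-t, by ring, by omega⟩
  obtain ⟨w, hw⟩ : ∃ w, B + r + s + t' = 4 * w := ⟨(B + r + s + t') / 4, by omega⟩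
  obtain ⟨x, hx⟩ : ∃ x, s + t' = 2 * x := ⟨(s + t') / 2, by omega⟩
  obtain ⟨y, hy⟩ : ∃ y, r + t' = 2 * y := ⟨(r + t') / 2, by omega⟩
  refine ⟨w, w - x, w - y, w + t' - x - y, ?_, by linarith⟩
  have e1 : s = 2 * x - t' := by linarith
  have e2 : r = 2 * y - t' := by linarith
  have e3 : B = 4 * w + t' - 2 * x - 2 * y := by linarith
  rw [← ht'] at hrst
  subst e1 e2 e3
  linarith

theorem exists_four_of_even (A B : ℤ) (hA : A % 4 = 2) (hB : B % 2 = 0) (h : B ^ 2 ≤ 4 * A) :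
    ∃ w x y z : ℤ, w ^ 2 + x ^ 2 + y ^ 2 + z ^ 2 = A ∧ w + x + y + z = B := by
  obtain ⟨C, rfl⟩ : ∃ C, B = 2 * C := ⟨B / 2, by omega⟩
  have hpar : ∀ r : ℤ, r ^ 2 % 4 = 1 ∧ r % 2 = 1 ∨ r ^ 2 % 4 = 0 ∧ r % 2 = 0 := by
    intro r
    have : r % 4 = 0 ∨ r % 4 = 1 ∨ r % 4 = 2 ∨ r % 4 = 3 := by omega
    rcases this with h | h | h | h <;>
      simp [pow_two, Int.mul_emod, h] <;> omega
  obtain ⟨r, s, t, hrst⟩ := isSumThreeSq_of_mod_eight (A - C ^ 2) (by linarith)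
    (by have := hpar C; omega)
  obtain ⟨w, hw⟩ : ∃ w, C + r + s + t = 2 * w := ⟨(C + r + s + t) / 2, by
    have := hpar r
    have := hpar s
    have := hpar t
    have := hpar C
    omega⟩
  refine ⟨w, w - s - t, w - r - t, w - r - s, ?_, by linarith⟩
  have : C = 2 * w - r - s - t := by linarith
  subst this
  linear_combination -hrst

/-! ### Choice of A and B. -/

theorem exists_eq_of_bounds (a b n A B : ℤ) (ha : 0 < a) (hb : 0 < b) (hn : n = a * A + b * B)
    (hpar : A % 2 = 1 ∧ B % 2 = 1 ∨ A % 4 = 2 ∧ B % 2 = 0) (hB : |B| ≤ 2 * a)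
    (hbound : a ^ 3 + 2 * a * b ≤ n) :
    ∃ w x y z : ℤ,
      n = w * (a * w + b) + x * (a * x + b) + y * (a * y + b) + z * (a * z + b) := by
  have hB' := abs_le.mp hB
  have h1 : B ^ 2 ≤ 4 * a ^ 2 := by nlinarith
  have h2 : b * B ≤ b * (2 * a) := mul_le_mul_of_nonneg_left hB'.2 hb.le
  have h3 : a ^ 2 ≤ A := le_of_mul_le_mul_left (by linarith) ha
  obtain ⟨w, x, y, z, hs, hl⟩ : ∃ w x y z : ℤ,
      w ^ 2 + x ^ 2 + y ^ 2 + z ^ 2 = A ∧ w + x + y + z = B := by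
    rcases hpar with h | h
    · exact exists_four_of_odd A B h.1 h.2 (by linarith)
    · exact exists_four_of_even A B h.1 h.2 (by linarith)
  exact ⟨w, x, y, z, by rw [hn, ← hs, ← hl]; ring⟩

theorem exists_eq_mul_add_mul (m c N : ℤ) (hm : 0 < m) (h : IsCoprime m c) :
    ∃ k t : ℤ, N = m * k + c * t ∧ |2 * t| ≤ m := by
  obtain ⟨u, v, huv⟩ := h
  obtain ⟨k, hk⟩ := exists_abs_two_mul_add_le m (N * v) hm
  exact ⟨N * u - c * k, N * v + k * m, by linear_combination (-N) * huv, hk⟩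

theorem theorem5p2 (a b : ℤ) (hb : 0 < b) (hab : b < a) (hpar : ¬ a ≡ b [ZMOD 2])
    (hgcd : Int.gcd a b = 1) :
    (2 ∣ a → ∀ n : ℕ,
      (n : ℚ) ≥ (2 : ℚ) ^ ((1 : ℤ) + (-1) ^ n) * (a : ℚ) ^ 3
        + (3 + (-1) ^ n) * (a : ℚ) * (b : ℚ) →
      ∃ w x y z : ℤ,
        (n : ℤ) = w * (a * w + b) + x * (a * x + b) + y * (a * y + b) + z * (a * z + b)) ∧
    (2 ∣ b → ∀ n : ℤ, n ≥ a ^ 3 + 2 * a * b → ¬ 4 ∣ n →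
      ∃ w x y z : ℤ,
        n = w * (a * w + b) + x * (a * x + b) + y * (a * y + b) + z * (a * z + b)) := by
  have ha : 0 < a := by omega
  have hcop : IsCoprime a b := Int.isCoprime_iff_gcd_eq_one.mpr hgcd
  unfold Int.ModEq at hpar
  have hprod : 0 < a * b := mul_pos ha hb
  have hcube : 0 < a ^ 3 := by positivity
  constructor
  · intro h2a n hn
    have hbodd : b % 2 = 1 := by omega
    have hcop2 : IsCoprime (2 * a) b :=
      IsCoprime.mul_left ⟨-(b / 2), 1, by omega⟩ hcop
    have hbound : a ^ 3 + 2 * a * b ≤ (n : ℤ) := by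
      rcases Nat.even_or_odd n with he | ho
      · rw [he.neg_one_pow, he.neg_one_pow] at hn
        norm_num at hn
        have : 4 * a ^ 3 + 4 * a * b ≤ (n : ℤ) := by exact_mod_cast hn
        linarith
      · rw [ho.neg_one_pow, ho.neg_one_pow] at hn
        norm_num at hn
        exact_mod_cast hn
    obtain ⟨a', rfl⟩ := h2a
    rcases Nat.even_or_odd' n with ⟨m, hm | hm⟩
    · obtain ⟨k, C, hk, hC⟩ := exists_eq_mul_add_mul (2 * (2 * a')) b (m - 2 * a') (by omega) hcop2
      refine exists_eq_of_bounds _ b n (4 * k + 2) (2 * C) ha hb ?_ (by omega) (by omega) hbound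
      rw [hm]; push_cast
      linear_combination 2 * hk
    · obtain ⟨k, B, hk, hB⟩ := exists_eq_mul_add_mul (2 * (2 * a')) b (n - 2 * a') (by omega) hcop2
      have hBodd : B % 2 = 1 := by
        have h1 : (b * B) % 2 = 1 := by
          have : b * B = n - 2 * a' - 2 * (2 * a' * k) := by linarith
          omega
        rw [Int.mul_emod, hbodd] at h1
        omega
      refine exists_eq_of_bounds _ b n (2 * k + 1) B ha hb ?_ (by omega) ?_ hbound
      · linear_combination hk
      · rw [abs_le] at hB ⊢
        omega
  · intro h2b n hn h4
    obtain ⟨b', rfl⟩ := h2b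
    have hcop2 : IsCoprime a (2 * (2 * b')) := by
      refine IsCoprime.mul_right ?_ hcop
      exact hcop.of_mul_right_left
    rcases Int.even_or_odd' n with ⟨m, hm | hm⟩
    · obtain ⟨A, C, hk, hC⟩ := exists_eq_mul_add_mul a (2 * (2 * b')) n ha hcop2
      -- Here 4 ∤ n enters: n is even, hence 2 mod 4.
      have h1 : (a * A) % 4 = 2 := by
        have : a * A = n - 4 * (b' * C) := by linarith
        omega
      have hA : A % 4 = 2 := by
        have h2 : a % 4 = 1 ∨ a % 4 = 3 := by omega
        rw [Int.mul_emod] at h1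
        rcases h2 with h2 | h2 <;> rw [h2] at h1 <;> omega
      refine exists_eq_of_bounds a (2 * b') n A (2 * C) ha hb (by linarith) (by omega) ?_ hn
      omega
    · obtain ⟨A, D, hk, hD⟩ := exists_eq_mul_add_mul a (2 * (2 * b')) (n - 2 * b') ha hcop2
      have hA : A % 2 = 1 := by
        have h1 : (a * A) % 2 = 1 := by
          have : a * A = n - 2 * b' - 2 * (2 * b' * D) := by linarith
          omega
        rw [Int.mul_emod, show a % 2 = 1 by omega] at h1
        omega
      refine exists_eq_of_bounds a (2 * b') n A (2 * D + 1) ha hb (by linarith) (by omega) ?_ hn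
      rw [abs_le] at hD ⊢
      omega
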